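/- Let $X$ be a compact, path-connected and locally path-connected topological space (in particular, any compact path-connected space admitting a universal cover in the usual sense), let $\mathfrak a\in H^1(X;\mathbb Z)$ be a singular cohomology class, let $\mathrm{Homeo}(X,\mathfrak a)$ be the group of homeomorphisms $h$ of $X$ with $h^*\mathfrak a=\mathfrak a$, and let $g\in \mathrm{Homeo}(X,\mathfrak a)$. Let $\alpha$ be an integral singular one-cocycle representing $\mathfrak a$ that is locally bounded: every point of $X$ has a neighbourhood $U$ such that the values $\int_\gamma\alpha$ on paths $\gamma$ in $U$ are bounded. For $x\in X$ and $h,k\in \mathrm{Homeo}(X,\mathfrak a)$ put $$\mathfrak G_{x}(h,k)=\int_\gamma (h^*\alpha-\alpha)\in\mathbb Z,$$ where $\gamma$ is a path from $x$ to $k(x)$; the value does not depend on $\gamma$, and $\mathfrak G_x$ is a two-cocycle on $\mathrm{Homeo}(X,\mathfrak a)$. If $\mathfrak G_x$ is bounded on the cyclic subgroup $\langle g\rangle$, the local rotation number of $g$ at $x$ is the class of the restriction of $\mathfrak G_x$ in the second bounded cohomology group $H^2_b(\langle g\rangle;\mathbb Z)$ (which is isomorphic to $\mathbb R/\mathbb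 Z$ if $g$ has infinite order). Let $x,y\in X$ be points such that $\mathfrak G_x$ and $\mathfrak G_y$ are bounded on $\langle g\rangle$. If the local rotation numbers of $g$ at $x$ and at $y$ are distinct, then $g$ is undistorted in $\mathrm{Homeo}(X,\mathfrak a)$; that is, for every finitely generated subgroup $\Gamma\le \mathrm{Homeo}(X,\mathfrak a)$ containing $g$ and every finite generating set $S$ of $\Gamma$, the translation length $\lim_{n\to\infty}|g^n|_S/n$ exists and is positive, where $|\cdot|_S$ is the word norm. -/

import Mathlib

open Filter Topology

universe u

noncomputable section

/-! ### Singular cochains and the first cohomology group -/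

/-- The singular `n`-simplices of `X`. -/
abbrev SingularSimplex (n : ℕ) (X : Type u) [TopologicalSpace X] : Type u :=
  C(stdSimplex ℝ (Fin (n + 1)), X)

/-- The singular `n`-cochains of `X` with coefficients in the abelian group `A`: homomorphisms from
the free abelian group on the singular `n`-simplices to `A`, given by their values on simplices. -/
abbrev SingularCochain (n : ℕ) (X : Type u) [TopologicalSpace X] (A : Type) [AddCommGroup A] :
    Type u :=
  SingularSimplex n X → A

/-- The `i`-th face inclusion of standard simplices. -/
def stdFace (n : ℕ) (i : Fin (n + 2)) :
    C(stdSimplex ℝ (Fin (n + 1)), stdSimplex ℝ (Fin (n + 2))) :=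
  ⟨stdSimplex.map i.succAbove, stdSimplex.continuous_map _⟩

/-- The singular coboundary, `(δφ)(σ) = ∑ᵢ (-1)ⁱ φ(σ ∘ δᵢ)`. -/
def singularCoboundary (n : ℕ) (X : Type u) [TopologicalSpace X] (A : Type) [AddCommGroup A] :
    SingularCochain n X A →+ SingularCochain (n + 1) X A where
  toFun φ σ := ∑ i : Fin (n + 2), (-1 : ℤ) ^ (i : ℕ) • φ (σ.comp (stdFace n i))
  map_zero' := by funext σ; simp
  map_add' φ ψ := by funext σ; simp [Finset.sum_add_distrib]

/-- The singular one-cocycles `Z¹(X; A)`. -/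
def singularZ1 (X : Type u) [TopologicalSpace X] (A : Type) [AddCommGroup A] :
    AddSubgroup (SingularCochain 1 X A) :=
  (singularCoboundary 1 X A).ker

/-- The singular one-coboundaries `B¹(X; A)`. -/
def singularB1 (X : Type u) [TopologicalSpace X] (A : Type) [AddCommGroup A] :
    AddSubgroup (SingularCochain 1 X A) :=
  (singularCoboundary 0 X A).range

/-- The singular cohomology group `H¹(X; A)`. -/
abbrev SingularH1 (X : Type u) [TopologicalSpace X] (A : Type) [AddCommGroup A] : Type u :=
  singularZ1 X A ⧸ (singularB1 X A).addSubgroupOf (singularZ1 X A)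

/-- The cohomology class of a singular one-cocycle. -/
def singularClass {X : Type u} [TopologicalSpace X] {A : Type} [AddCommGroup A]
    (α : singularZ1 X A) : SingularH1 X A :=
  QuotientAddGroup.mk α

/-- The pullback of singular cochains by a continuous map, `(f^*φ)(σ) = φ(f ∘ σ)`. -/
def cochainPullback {X Y : Type u} [TopologicalSpace X] [TopologicalSpace Y] (n : ℕ) (A : Type)
    [AddCommGroup A] (f : C(X, Y)) : SingularCochain n Y A →+ SingularCochain n X A where
  toFun φ σ := φ (f.comp σ)
  map_zero' := rfl
  map_add' _ _ := rfl

theorem coboundary_pullback {X Y : Type u} [TopologicalSpace X] [TopologicalSpace Y] (n : ℕ)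
    {A : Type} [AddCommGroup A] (f : C(X, Y)) (φ : SingularCochain n Y A) :
    singularCoboundary n X A (cochainPullback n A f φ) =
      cochainPullback (n + 1) A f (singularCoboundary n Y A φ) := rfl

/-- The pullback of singular one-cocycles. -/
def cocyclePullback {X Y : Type u} [TopologicalSpace X] [TopologicalSpace Y] (A : Type)
    [AddCommGroup A] (f : C(X, Y)) : singularZ1 Y A →+ singularZ1 X A :=
  ((cochainPullback 1 A f).comp (singularZ1 Y A).subtype).codRestrict (singularZ1 X A) fun α => by
    have h : singularCoboundary 1 Y A α = 0 := α.2
    change singularCoboundary 1 X A (cochainPullback 1 A f α) = 0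
    rw [coboundary_pullback, h, map_zero]

/-- The map `f^* : H¹(Y; A) → H¹(X; A)` induced by a continuous map `f : X → Y`. -/
def h1Pullback {X Y : Type u} [TopologicalSpace X] [TopologicalSpace Y] (A : Type)
    [AddCommGroup A] (f : C(X, Y)) : SingularH1 Y A →+ SingularH1 X A :=
  QuotientAddGroup.map _ _ (cocyclePullback A f) (by
    rintro α ⟨φ, hφ⟩
    refine ⟨cochainPullback 0 A f φ, ?_⟩
    rw [coboundary_pullback, hφ]
    rfl)

/-- `Homeo(X, a)`: the group of homeomorphisms `g` of `X` such that `g^* a = a`. -/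
def homeoFixing {X : Type u} [TopologicalSpace X] {A : Type} [AddCommGroup A]
    (a : SingularH1 X A) : Subgroup (X ≃ₜ X) where
  carrier := {g | h1Pullback A (g : C(X, X)) a = a}
  one_mem' := by
    induction a using QuotientAddGroup.induction_on with
    | H α => rfl
  mul_mem' := by
    intro g h hg hh
    have key : h1Pullback A ((g * h : X ≃ₜ X) : C(X, X)) a =
        h1Pullback A (h : C(X, X)) (h1Pullback A (g : C(X, X)) a) := by
      induction a using QuotientAddGroup.induction_on with
      | H α => rfl
    have hg' : h1Pullback A (g : C(X, X)) a = a := hg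
    have hh' : h1Pullback A (h : C(X, X)) a = a := hh
    change h1Pullback A ((g * h : X ≃ₜ X) : C(X, X)) a = a
    rw [key, hg', hh']
  inv_mem' := by
    intro g hg
    have key : h1Pullback A ((g⁻¹ : X ≃ₜ X) : C(X, X)) (h1Pullback A (g : C(X, X)) a) = a := by
      have : (g : C(X, X)).comp ((g⁻¹ : X ≃ₜ X) : C(X, X)) = ContinuousMap.id X := by
        ext x; exact g.apply_symm_apply x
      induction a using QuotientAddGroup.induction_on with
      | H α =>
        change singularClass _ = singularClass _
        congr 1
        apply Subtype.ext
        funext σ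
        change α.1 (((g : C(X, X)).comp ((g⁻¹ : X ≃ₜ X) : C(X, X))).comp σ) = α.1 σ
        rw [this, ContinuousMap.id_comp]
    have hg' : h1Pullback A (g : C(X, X)) a = a := hg
    rw [hg'] at key
    exact key

/-! ### The two-cocycle on `Homeo(X, a)` -/

/-- A path, regarded as a singular one-simplex. -/
def pathSimplex {X : Type u} [TopologicalSpace X] {x y : X} (γ : Path x y) :
    SingularSimplex 1 X :=
  γ.toContinuousMap.comp
    ⟨stdSimplexHomeomorphUnitInterval, stdSimplexHomeomorphUnitInterval.continuous⟩

/-- The pairing `∫_γ φ` of a path with a singular one-cochain. -/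
def pathIntegral {X : Type u} [TopologicalSpace X] {A : Type} [AddCommGroup A]
    (φ : SingularCochain 1 X A) {x y : X} (γ : Path x y) : A :=
  φ (pathSimplex γ)

/-- The function `G_{x,α}(g, h) = ∫_γ (g^*α - α)`, where `γ` is a path from `x` to `h x`.
For `g` preserving the class of `α`, the value does not depend on `γ`: see `gCocycle_eq_path`. -/
def gCocycle {X : Type u} [TopologicalSpace X] [PathConnectedSpace X] {A : Type} [AddCommGroup A]
    (α : singularZ1 X A) (x : X) (g h : X ≃ₜ X) : A :=
  pathIntegral (cochainPullback 1 A (g : C(X, X)) α.1 - α.1) (PathConnectedSpace.somePath x (h x))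

/-- A singular one-cocycle with integer values is locally bounded if every point has a
neighbourhood `U` such that the values on the paths in `U` are bounded. -/
def IsLocallyBoundedCocycle {X : Type u} [TopologicalSpace X] (α : singularZ1 X ℤ) : Prop :=
  ∀ p : X, ∃ U ∈ 𝓝 p, ∃ C : ℤ, ∀ (y z : X) (γ : Path y z), Set.range γ ⊆ U →
    |pathIntegral α.1 γ| ≤ C

theorem coboundary_path {X : Type u} [TopologicalSpace X] {A : Type} [AddCommGroup A]
    (φ : SingularCochain 0 X A) {x y : X} (γ : Path x y) :
    pathIntegral (singularCoboundary 0 X A φ) γ =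
      φ (ContinuousMap.const _ y) - φ (ContinuousMap.const _ x) := by
  have key : ∀ i : Fin 2, ∀ z : X, (pathSimplex γ) (stdSimplex.vertex (i.succAbove 0)) = z →
      (pathSimplex γ).comp (stdFace 0 i) = ContinuousMap.const _ z := by
    intro i z hz
    ext t
    have ht : t = stdSimplex.vertex (S := ℝ) (0 : Fin 1) := Subsingleton.elim _ _
    subst ht
    change (pathSimplex γ) (stdSimplex.map i.succAbove (stdSimplex.vertex 0)) = z
    rw [stdSimplex.map_vertex, hz]
  have h1 : (pathSimplex γ) (stdSimplex.vertex (1 : Fin 2)) = y := by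
    change γ (stdSimplexHomeomorphUnitInterval (stdSimplex.vertex (1 : Fin 2))) = y
    have : stdSimplexHomeomorphUnitInterval (stdSimplex.vertex (S := ℝ) (1 : Fin 2)) = 1 :=
      stdSimplexHomeomorphUnitInterval_one
    rw [this, γ.target]
  have h0 : (pathSimplex γ) (stdSimplex.vertex (0 : Fin 2)) = x := by
    change γ (stdSimplexHomeomorphUnitInterval (stdSimplex.vertex (0 : Fin 2))) = x
    have : stdSimplexHomeomorphUnitInterval (stdSimplex.vertex (S := ℝ) (0 : Fin 2)) = 0 :=
      stdSimplexHomeomorphUnitInterval_zero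
    rw [this, γ.source]
  change ∑ i : Fin 2, (-1 : ℤ) ^ (i : ℕ) • φ ((pathSimplex γ).comp (stdFace 0 i)) = _
  rw [Fin.sum_univ_two, key 0 y h1, key 1 x h0]
  simp [sub_eq_add_neg]

/-- If `g` preserves the class of `α`, then `g^*α - α` is the coboundary of a function. -/
theorem exists_primitive {X : Type u} [TopologicalSpace X] {A : Type} [AddCommGroup A]
    {a : SingularH1 X A} {α : singularZ1 X A} (hα : singularClass α = a) (g : homeoFixing a) :
    ∃ φ : SingularCochain 0 X A, singularCoboundary 0 X A φ =
      cochainPullback 1 A ((g : X ≃ₜ X) : C(X, X)) α.1 - α.1 := by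
  have hg : h1Pullback A ((g : X ≃ₜ X) : C(X, X)) a = a := g.2
  subst hα
  have hg' : singularClass α =
      singularClass (cocyclePullback A ((g : X ≃ₜ X) : C(X, X)) α) := hg.symm
  obtain ⟨φ, hφ⟩ := QuotientAddGroup.eq.mp hg'
  refine ⟨φ, hφ.trans ?_⟩
  change -α.1 + cochainPullback 1 A ((g : X ≃ₜ X) : C(X, X)) α.1 = _
  abel

theorem gCocycle_eq_sub {X : Type u} [TopologicalSpace X] [PathConnectedSpace X] {A : Type}
    [AddCommGroup A] {α : singularZ1 X A} {g : X ≃ₜ X} {φ : SingularCochain 0 X A}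
    (hφ : singularCoboundary 0 X A φ = cochainPullback 1 A (g : C(X, X)) α.1 - α.1)
    (x : X) (h : X ≃ₜ X) :
    gCocycle α x g h = φ (ContinuousMap.const _ (h x)) - φ (ContinuousMap.const _ x) := by
  rw [gCocycle, ← hφ, coboundary_path]

theorem gCocycle_eq_path {X : Type u} [TopologicalSpace X] [PathConnectedSpace X] {A : Type}
    [AddCommGroup A] {a : SingularH1 X A} {α : singularZ1 X A} (hα : singularClass α = a)
    (x : X) (g : homeoFixing a) (h : X ≃ₜ X) (γ : Path x (h x)) :
    gCocycle α x g h =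
      pathIntegral (cochainPullback 1 A ((g : X ≃ₜ X) : C(X, X)) α.1 - α.1) γ := by
  obtain ⟨φ, hφ⟩ := exists_primitive hα g
  rw [gCocycle_eq_sub hφ, ← hφ, coboundary_path]

theorem gCocycle_cocycle {X : Type u} [TopologicalSpace X] [PathConnectedSpace X] {A : Type}
    [AddCommGroup A] {a : SingularH1 X A} {α : singularZ1 X A} (hα : singularClass α = a)
    (x : X) (g h k : homeoFixing a) :
    gCocycle α x h k - gCocycle α x ((g * h : homeoFixing a) : X ≃ₜ X) k
      + gCocycle α x g ((h * k : homeoFixing a) : X ≃ₜ X) - gCocycle α x g h = 0 := by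
  obtain ⟨φ, hφ⟩ := exists_primitive hα g
  obtain ⟨ψ, hψ⟩ := exists_primitive hα h
  have hgh : singularCoboundary 0 X A (cochainPullback 0 A ((h : X ≃ₜ X) : C(X, X)) φ + ψ) =
      cochainPullback 1 A (((g * h : homeoFixing a) : X ≃ₜ X) : C(X, X)) α.1 - α.1 := by
    rw [map_add, coboundary_pullback, hφ, hψ, map_sub, sub_add_sub_cancel]
    rfl
  rw [gCocycle_eq_sub hφ, gCocycle_eq_sub hψ, gCocycle_eq_sub hφ, gCocycle_eq_sub hgh]
  have e : ∀ z : X, (cochainPullback 0 A ((h : X ≃ₜ X) : C(X, X)) φ + ψ) (ContinuousMap.const _ z) =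
      φ (ContinuousMap.const _ ((h : X ≃ₜ X) z)) + ψ (ContinuousMap.const _ z) := fun _ => rfl
  have m : ((h * k : homeoFixing a) : X ≃ₜ X) x = (h : X ≃ₜ X) ((k : X ≃ₜ X) x) := rfl
  rw [e, e, m]
  abel

/-! ### Bounded cohomology with integer coefficients -/

/-- Bounded one-cochains on a group, with integer values. -/
def boundedC1 (Γ : Type u) : AddSubgroup (Γ → ℤ) where
  carrier := {b | ∃ C : ℤ, ∀ g, |b g| ≤ C}
  zero_mem' := ⟨0, fun _ => by simp⟩
  add_mem' := by
    rintro b c ⟨B, hB⟩ ⟨C, hC⟩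
    exact ⟨B + C, fun g => (abs_add_le _ _).trans (add_le_add (hB g) (hC g))⟩
  neg_mem' := by
    rintro b ⟨B, hB⟩
    exact ⟨B, fun g => by simpa using hB g⟩

/-- Bounded (inhomogeneous) two-cocycles on a group, with integer values. -/
def boundedZ2 (Γ : Type u) [Group Γ] : AddSubgroup (Γ → Γ → ℤ) where
  carrier := {c | (∃ C : ℤ, ∀ g h, |c g h| ≤ C) ∧
    ∀ g h k, c h k - c (g * h) k + c g (h * k) - c g h = 0}
  zero_mem' := ⟨⟨0, fun _ _ => by simp⟩, fun _ _ _ => by simp⟩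
  add_mem' := by
    rintro b c ⟨⟨B, hB⟩, hb⟩ ⟨⟨C, hC⟩, hc⟩
    refine ⟨⟨B + C, fun g h => (abs_add_le _ _).trans (add_le_add (hB g h) (hC g h))⟩, ?_⟩
    intro g h k
    have h1 := hb g h k
    have h2 := hc g h k
    simp only [Pi.add_apply]
    linarith
  neg_mem' := by
    rintro b ⟨⟨B, hB⟩, hb⟩
    refine ⟨⟨B, fun g h => by simpa using hB g h⟩, ?_⟩
    intro g h k
    have h1 := hb g h k
    simp only [Pi.neg_apply]
    linarith

/-- The group coboundary of one-cochains, `(δb)(g, h) = b(h) - b(gh) + b(g)`. -/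
def groupCoboundary1 (Γ : Type u) [Group Γ] : (Γ → ℤ) →+ (Γ → Γ → ℤ) where
  toFun b g h := b h - b (g * h) + b g
  map_zero' := by funext g h; simp
  map_add' b c := by funext g h; simp only [Pi.add_apply]; ring

/-- The coboundaries of bounded one-cochains. -/
def boundedB2 (Γ : Type u) [Group Γ] : AddSubgroup (Γ → Γ → ℤ) :=
  (boundedC1 Γ).map (groupCoboundary1 Γ)

/-- The second bounded cohomology group `H²_b(Γ; ℤ)`. -/
abbrev BoundedH2 (Γ : Type u) [Group Γ] : Type u :=
  boundedZ2 Γ ⧸ (boundedB2 Γ).addSubgroupOf (boundedZ2 Γ)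

/-- `G_{x,α}` is bounded on the cyclic subgroup generated by `g`. -/
def IsBoundedOnPowers {X : Type u} [TopologicalSpace X] [PathConnectedSpace X]
    {a : SingularH1 X ℤ} (α : singularZ1 X ℤ) (x : X) (g : homeoFixing a) : Prop :=
  ∃ C : ℤ, ∀ u v : Subgroup.zpowers g,
    |gCocycle α x (u : homeoFixing a) (v : homeoFixing a)| ≤ C

/-- The restriction of `G_{x,α}` to the cyclic subgroup generated by `g`, as a bounded cocycle. -/
def restrictedCocycle {X : Type u} [TopologicalSpace X] [PathConnectedSpace X]
    {a : SingularH1 X ℤ} {α : singularZ1 X ℤ} (hα : singularClass α = a) {x : X}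
    {g : homeoFixing a} (hb : IsBoundedOnPowers α x g) : boundedZ2 (Subgroup.zpowers g) :=
  ⟨fun u v => gCocycle α x (u : homeoFixing a) (v : homeoFixing a),
    hb, fun u v w => gCocycle_cocycle hα x u v w⟩

/-- The local rotation number of `g` at `x`: the class of `G_{x,α}` in `H²_b(⟨g⟩; ℤ)`. -/
def localRotationNumber {X : Type u} [TopologicalSpace X] [PathConnectedSpace X]
    {a : SingularH1 X ℤ} {α : singularZ1 X ℤ} (hα : singularClass α = a) {x : X}
    {g : homeoFixing a} (hb : IsBoundedOnPowers α x g) : BoundedH2 (Subgroup.zpowers g) :=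
  QuotientAddGroup.mk (restrictedCocycle hα hb)

/-! ### Distortion -/

/-- The word norm with respect to `S`: the least length of a word in the elements of `S` and their
inverses that represents `g`. -/
def wordNorm {Γ : Type u} [Group Γ] (S : Set Γ) (g : Γ) : ℕ :=
  sInf {k : ℕ | ∃ l : List Γ, l.length = k ∧ (∀ s ∈ l, s ∈ S ∨ s⁻¹ ∈ S) ∧ l.prod = g}

/-- `τ` is the translation length of `g` with respect to `S`. -/
def IsTranslationLength {Γ : Type u} [Group Γ] (S : Set Γ) (g : Γ) (τ : ℝ) : Prop :=
  Tendsto (fun n : ℕ => (wordNorm S (g ^ n) : ℝ) / n) atTop (𝓝 τ)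

/-- An element of a finitely generated group is undistorted if its translation length is positive
with respect to every finite generating set. -/
def IsUndistortedFG {Γ : Type u} [Group Γ] (g : Γ) : Prop :=
  ∀ S : Set Γ, S.Finite → Subgroup.closure S = ⊤ → ∃ τ : ℝ, 0 < τ ∧ IsTranslationLength S g τ

/-- An element of a group is undistorted if it is undistorted in every finitely generated subgroup
that contains it. -/
def IsUndistorted {G : Type u} [Group G] (g : G) : Prop :=
  ∀ (Γ : Subgroup G) (hg : g ∈ Γ), Γ.FG → IsUndistortedFG (⟨g, hg⟩ : Γ)

end

/-! ### Word norms and translation lengths -/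

/-! For `h` fixing the class of `α`, write `h^*α - α = δφ_h` and let `V(h) = φ_h(y) - φ_h(x)`; this
is `pullbackVariation α x y h`. Two estimates on `V` are played against each other. Lower bound: the
two cocycles differ by `δV` (`gCocycle_sub_gCocycle`). If `V` were bounded on `⟨g⟩`, the local
rotation numbers would agree; so `V` is unbounded there, while `δV` is bounded as a difference of
bounded cocycles. An unbounded quasimorphism on a cyclic group grows linearly
(`exists_linear_growth_of_unbounded`). Upper bound: compactness and local boundedness of `α` bound
the oscillation of each `φ_h`, and the chain rule `pullbackVariation_mul` makes oscillation
subadditive, so `|V(h)| ≤ M * |h|_S`. Together, `k ≤ M * |g ^ (m * k)|_S`, which forces positive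
translation length. -/

theorem exists_list_length_eq_wordNorm {Γ : Type u} [Group Γ] {S : Set Γ}
    (hS : Subgroup.closure S = ⊤) (g : Γ) :
    ∃ l : List Γ, l.length = wordNorm S g ∧ (∀ s ∈ l, s ∈ S ∨ s⁻¹ ∈ S) ∧ l.prod = g := by
  -- The infimum is attained only if some word represents `g`; on the empty set `sInf` would be the
  -- default value `0`.
  refine Nat.sInf_mem (s := {k : ℕ | ∃ l : List Γ, l.length = k ∧
    (∀ s ∈ l, s ∈ S ∨ s⁻¹ ∈ S) ∧ l.prod = g}) ?_
  have hg : g ∈ (Subgroup.closure S).toSubmonoid := by rw [hS]; trivial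
  rw [Subgroup.closure_toSubmonoid] at hg
  obtain ⟨l, hl, hlg⟩ := Submonoid.exists_list_of_mem_closure hg
  exact ⟨l.length, l, rfl, hl, hlg⟩

theorem wordNorm_mul_le {Γ : Type u} [Group Γ] {S : Set Γ} (hS : Subgroup.closure S = ⊤)
    (g h : Γ) : wordNorm S (g * h) ≤ wordNorm S g + wordNorm S h := by
  obtain ⟨l, hl, hlS, hlg⟩ := exists_list_length_eq_wordNorm hS g
  obtain ⟨m, hm, hmS, hmh⟩ := exists_list_length_eq_wordNorm hS h
  refine Nat.sInf_le ⟨l ++ m, by simp [hl, hm], fun s hs => ?_, by simp [hlg, hmh]⟩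
  exact (List.mem_append.mp hs).elim (hlS s) (hmS s)

/-- Fekete's lemma for a subadditive sequence bounded below by `0`. -/
theorem exists_isTranslationLength {Γ : Type u} [Group Γ] {S : Set Γ}
    (hS : Subgroup.closure S = ⊤) (g : Γ) : ∃ τ : ℝ, IsTranslationLength S g τ := by
  have hsub : Subadditive fun n : ℕ => (wordNorm S (g ^ n) : ℝ) := fun m n => by
    simp only [pow_add]
    exact_mod_cast wordNorm_mul_le hS (g ^ m) (g ^ n)
  refine ⟨_, hsub.tendsto_lim ⟨0, ?_⟩⟩
  rintro _ ⟨n, rfl⟩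
  positivity

/-- As the limit exists, it can be computed along the multiples of `m`, where the quotients are at
least `1 / (m * M)`. -/
theorem IsTranslationLength.pos_of_linear_growth {Γ : Type u} [Group Γ] {S : Set Γ} {g : Γ}
    {τ : ℝ} (hτ : IsTranslationLength S g τ) {m M : ℕ} (hm : 0 < m) (hM : 0 < M)
    (h : ∀ k : ℕ, k ≤ M * wordNorm S (g ^ (m * k))) : 0 < τ := by
  have hlim : Tendsto (fun k : ℕ => m * k) atTop atTop :=
    tendsto_id.const_mul_atTop' hm
  have hpos : (0 : ℝ) < 1 / (m * M) := by positivity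
  refine hpos.trans_le (ge_of_tendsto (hτ.comp hlim) ?_)
  filter_upwards [eventually_gt_atTop 0] with k hk
  have h' : (k : ℝ) ≤ M * wordNorm S (g ^ (m * k)) := by exact_mod_cast h k
  have hk' : (0 : ℝ) < k := by exact_mod_cast hk
  have hm' : (0 : ℝ) < m := by exact_mod_cast hm
  have hM' : (0 : ℝ) < M := by exact_mod_cast hM
  simp only [Function.comp_apply, Nat.cast_mul]
  rw [div_le_div_iff₀ (by positivity) (by positivity)]
  nlinarith

/-! ### Integer-valued quasimorphisms on cyclic groups -/

/-- An unbounded quasimorphism on the powers of an element grows linearly along a sequence of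
positive powers. -/
theorem exists_linear_growth_of_unbounded {Γ : Type u} [Group Γ] {g : Γ} {f : Γ → ℤ} {C : ℤ}
    (hC : ∀ m n : ℤ, |f (g ^ n) - f (g ^ (m + n)) + f (g ^ m)| ≤ C)
    (hf : ∀ B : ℤ, ∃ n : ℤ, B < |f (g ^ n)|) :
    ∃ m : ℕ, 0 < m ∧ ∀ k : ℕ, (k : ℤ) ≤ |f (g ^ (m * k))| := by
  have h0 : |f 1| ≤ C := by simpa using hC 0 0
  have hpos : ∃ m : ℕ, C < |f (g ^ m)| := by
    -- Replacing a negative exponent by its opposite costs at most `C + |f 1| ≤ 2 * C`, so a value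
    -- above `3 * C` leaves more than `C`.
    obtain ⟨n, hn⟩ := hf (3 * C)
    have hC0 : 0 ≤ C := (abs_nonneg _).trans h0
    obtain ⟨m, rfl | rfl⟩ := n.eq_nat_or_neg
    · exact ⟨m, by rw [zpow_natCast] at hn; linarith⟩
    · have h1 := hC m (-m)
      rw [add_neg_cancel, zpow_zero, zpow_natCast] at h1
      refine ⟨m, ?_⟩
      grind
  obtain ⟨m, hm⟩ := hpos
  -- Here `σ` is the sign of `f (g ^ m)`. By integrality `σ * f (g ^ m) ≥ C + 1`, so each further
  -- factor `g ^ m` gains at least `1` after the defect `C` is paid.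
  have key : ∀ σ : ℤ, |σ| = 1 → C < σ * f (g ^ m) → ∀ k : ℕ, k + 1 + C ≤ σ * f (g ^ (m * (k + 1))) := by
    intro σ hσ hm k
    have hσ' : σ = 1 ∨ σ = -1 := by grind
    induction k with
    | zero => simp; linarith
    | succ k ih =>
      have h1 := hC (m * (k + 1) : ℕ) m
      rw [← Nat.cast_add, zpow_natCast, zpow_natCast, zpow_natCast] at h1
      rw [show m * (k + 1 + 1) = m * (k + 1) + m by ring]
      push_cast
      rcases hσ' with rfl | rfl <;> grind
  have hC0 : 0 ≤ C := (abs_nonneg _).trans h0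
  refine ⟨m, Nat.pos_of_ne_zero ?_, fun k => ?_⟩
  -- The exponent `0` is excluded because `|f 1| ≤ C`.
  · rintro rfl
    rw [pow_zero] at hm
    exact absurd h0 (not_le.mpr hm)
  · rcases k with _ | k
    · simp
    · rcases lt_abs.mp hm with h | h
      · have h1 := key 1 (by simp) (by simpa using h) k
        rw [one_mul] at h1
        refine le_trans ?_ (le_abs_self _)
        push_cast
        linarith
      · have h1 := key (-1) (by simp) (by simpa using h) k
        rw [neg_one_mul] at h1
        refine le_trans ?_ (neg_le_abs _)
        push_cast
        linarith

/-! ### Variation of the primitives of `h^*α - α` -/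

/-- The integral of `h^*α - α` along a path from `x` to `y`. -/
noncomputable def pullbackVariation {X : Type u} [TopologicalSpace X] [PathConnectedSpace X] {A : Type}
    [AddCommGroup A] (α : singularZ1 X A) (x y : X) (h : X ≃ₜ X) : A :=
  pathIntegral (cochainPullback 1 A (h : C(X, X)) α.1 - α.1) (PathConnectedSpace.somePath x y)

theorem pullbackVariation_eq_sub {X : Type u} [TopologicalSpace X] [PathConnectedSpace X]
    {A : Type} [AddCommGroup A] {α : singularZ1 X A} {h : X ≃ₜ X} {φ : SingularCochain 0 X A}
    (hφ : singularCoboundary 0 X A φ = cochainPullback 1 A (h : C(X, X)) α.1 - α.1) (x y : X) :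
    pullbackVariation α x y h = φ (ContinuousMap.const _ y) - φ (ContinuousMap.const _ x) := by
  rw [pullbackVariation, ← hφ, coboundary_path]

/-- Chain rule: `(gh)^*α - α = h^*(g^*α - α) + (h^*α - α)`, so `h^*φ + ψ` is a primitive for `gh`
when `φ` and `ψ` are primitives for `g` and `h`. -/
theorem pullbackVariation_mul {X : Type u} [TopologicalSpace X] [PathConnectedSpace X] {A : Type}
    [AddCommGroup A] {a : SingularH1 X A} {α : singularZ1 X A} (hα : singularClass α = a)
    (x y : X) (g h : homeoFixing a) :
    pullbackVariation α x y ((g * h : homeoFixing a) : X ≃ₜ X) =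
      pullbackVariation α ((h : X ≃ₜ X) x) ((h : X ≃ₜ X) y) g + pullbackVariation α x y h := by
  obtain ⟨φ, hφ⟩ := exists_primitive hα g
  obtain ⟨ψ, hψ⟩ := exists_primitive hα h
  have hgh : singularCoboundary 0 X A (cochainPullback 0 A ((h : X ≃ₜ X) : C(X, X)) φ + ψ) =
      cochainPullback 1 A (((g * h : homeoFixing a) : X ≃ₜ X) : C(X, X)) α.1 - α.1 := by
    rw [map_add, coboundary_pullback, hφ, hψ, map_sub, sub_add_sub_cancel]
    rfl
  rw [pullbackVariation_eq_sub hφ, pullbackVariation_eq_sub hψ, pullbackVariation_eq_sub hgh]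
  have e : ∀ z : X, (cochainPullback 0 A ((h : X ≃ₜ X) : C(X, X)) φ + ψ) (ContinuousMap.const _ z) =
      φ (ContinuousMap.const _ ((h : X ≃ₜ X) z)) + ψ (ContinuousMap.const _ z) := fun _ => rfl
  rw [e, e]
  abel

theorem pullbackVariation_one {X : Type u} [TopologicalSpace X] [PathConnectedSpace X] {A : Type}
    [AddCommGroup A] (α : singularZ1 X A) (x y : X) : pullbackVariation α x y 1 = 0 := by
  have h : cochainPullback 1 A ((1 : X ≃ₜ X) : C(X, X)) α.1 = α.1 := rfl
  rw [pullbackVariation, h, sub_self]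
  rfl

/-- The chain rule cancels the contribution of `h`, leaving an identity between the values of one
primitive of `g^*α - α` at `x`, `y`, `h x`, `h y`. Thus changing the base point alters the cocycle
by a coboundary, though possibly of an unbounded cochain. -/
theorem gCocycle_sub_gCocycle {X : Type u} [TopologicalSpace X] [PathConnectedSpace X] {A : Type}
    [AddCommGroup A] {a : SingularH1 X A} {α : singularZ1 X A} (hα : singularClass α = a)
    (x y : X) (g h : homeoFixing a) :
    gCocycle α x g h - gCocycle α y g h =
      pullbackVariation α x y h - pullbackVariation α x y ((g * h : homeoFixing a) : X ≃ₜ X) +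
        pullbackVariation α x y g := by
  rw [pullbackVariation_mul hα]
  obtain ⟨φ, hφ⟩ := exists_primitive hα g
  rw [gCocycle_eq_sub hφ, gCocycle_eq_sub hφ, pullbackVariation_eq_sub hφ,
    pullbackVariation_eq_sub hφ]
  abel

/-- A function on a compact locally path-connected space is bounded if its increments along short
paths are bounded near every point. -/
theorem exists_abs_le_of_locally_bounded_increments {X : Type u} [TopologicalSpace X]
    [CompactSpace X] [LocallyPathConnectedSpace X] (f : X → ℤ)
    (hf : ∀ p : X, ∃ U ∈ 𝓝 p, ∃ C : ℤ, ∀ (y z : X) (γ : Path y z), Set.range γ ⊆ U →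
      |f z - f y| ≤ C) : ∃ C : ℤ, ∀ z, |f z| ≤ C := by
  suffices h : ∃ C : ℤ, ∀ z ∈ (Set.univ : Set X), |f z| ≤ C from
    h.imp fun C hC z => hC z trivial
  refine isCompact_univ.induction_on (p := fun s => ∃ C : ℤ, ∀ z ∈ s, |f z| ≤ C)
    ⟨0, by simp⟩ (fun s t hst => ?_) (fun s t => ?_) (fun p _ => ?_)
  · exact fun ⟨C, hC⟩ => ⟨C, fun z hz => hC z (hst hz)⟩
  · rintro ⟨C, hC⟩ ⟨D, hD⟩
    exact ⟨max C D, fun z hz => hz.elim (fun h => (hC z h).trans (le_max_left _ _))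
      fun h => (hD z h).trans (le_max_right _ _)⟩
  · obtain ⟨U, hU, C, hC⟩ := hf p
    -- A path-connected `V ⊆ U` lets every point of `V` be reached from `p` by a path to which the
    -- bound on `U` applies.
    obtain ⟨V, ⟨hV, hVc⟩, hVU⟩ := (path_connected_basis p).mem_iff.mp hU
    refine ⟨V, by rwa [nhdsWithin_univ], C + |f p|, fun z hz => ?_⟩
    obtain ⟨γ, hγ⟩ := hVc.joinedIn p (mem_of_mem_nhds hV) z hz
    have h1 := hC p z γ (Set.range_subset_iff.mpr fun t => hVU (hγ t))
    have h2 := abs_add_le (f z - f p) (f p)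
    rw [sub_add_cancel] at h2
    linarith

/-- The variation of the primitives of `h^*α - α` is bounded on a compact space. -/
theorem exists_abs_pullbackVariation_le {X : Type u} [TopologicalSpace X] [CompactSpace X]
    [PathConnectedSpace X] [LocallyPathConnectedSpace X] {a : SingularH1 X ℤ} {α : singularZ1 X ℤ}
    (hα : singularClass α = a) (hloc : IsLocallyBoundedCocycle α) (h : homeoFixing a) :
    ∃ C : ℤ, ∀ x y : X, |pullbackVariation α x y h| ≤ C := by
  obtain ⟨φ, hφ⟩ := exists_primitive hα h
  obtain ⟨C, hC⟩ := exists_abs_le_of_locally_bounded_increments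
    (fun z : X => φ (ContinuousMap.const _ z)) fun p => by
      obtain ⟨U, hU, C, hC⟩ := hloc p
      -- The integral of `h^*α` along `γ` is that of `α` along `h ∘ γ`, so a local bound near `h p`
      -- is needed as well.
      obtain ⟨V, hV, D, hD⟩ := hloc ((h : X ≃ₜ X) p)
      refine ⟨U ∩ (h : X ≃ₜ X) ⁻¹' V,
        Filter.inter_mem hU ((h : X ≃ₜ X).continuous.continuousAt hV), D + C, fun y z γ hγ => ?_⟩
      have h1 := hC y z γ fun w hw => (hγ hw).1
      have h2 := hD _ _ (γ.map (h : X ≃ₜ X).continuous) (by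
        rintro _ ⟨t, rfl⟩
        exact (hγ ⟨t, rfl⟩).2)
      rw [← coboundary_path φ γ, hφ]
      exact (abs_sub _ _).trans (add_le_add h2 h1)
  refine ⟨C + C, fun x y => ?_⟩
  rw [pullbackVariation_eq_sub hφ]
  exact (abs_sub _ _).trans (add_le_add (hC y) (hC x))

/-- On a finitely generated group of homeomorphisms, the variation of the primitives of
`h^*α - α` grows at most linearly in the word norm. -/
theorem exists_abs_pullbackVariation_le_wordNorm {X : Type u} [TopologicalSpace X] [CompactSpace X]
    [PathConnectedSpace X] [LocallyPathConnectedSpace X] {a : SingularH1 X ℤ} {α : singularZ1 X ℤ}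
    (hα : singularClass α = a) (hloc : IsLocallyBoundedCocycle α) {Γ : Subgroup (homeoFixing a)}
    {S : Set Γ} (hSfin : S.Finite) (hS : Subgroup.closure S = ⊤) :
    ∃ M : ℕ, 0 < M ∧ ∀ (h : Γ) (x y : X),
      |pullbackVariation α x y (h : homeoFixing a)| ≤ M * wordNorm S h := by
  choose C hC using exists_abs_pullbackVariation_le hα hloc
  -- Words also use inverses of generators. If `S` is empty, `B` may be negative, hence `B.toNat +
  -- 1` below.
  obtain ⟨B, hB⟩ := ((hSfin.union hSfin.inv).image fun s : Γ => C s).bddAbove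
  refine ⟨B.toNat + 1, Nat.succ_pos _, fun h => ?_⟩
  obtain ⟨l, hl, hlS, rfl⟩ := exists_list_length_eq_wordNorm hS h
  rw [← hl]
  clear hl
  induction l with
  | nil =>
    intro x y
    simp [pullbackVariation_one]
  | cons s l ih =>
    intro x y
    have hs : C s ≤ B := hB ⟨s, hlS s List.mem_cons_self, rfl⟩
    have h1 := ih (fun t ht => hlS t (List.mem_cons_of_mem _ ht)) x y
    -- The chain rule moves the endpoints by the tail of the word; this is why `C s` has to be
    -- uniform in both points.
    have h2 := hC s (((l.prod : Γ) : homeoFixing a).1 x) (((l.prod : Γ) : homeoFixing a).1 y)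
    have h3 : B ≤ (B.toNat + 1 : ℕ) := by omega
    rw [List.prod_cons, Subgroup.coe_mul, pullbackVariation_mul hα]
    refine (abs_add_le _ _).trans ?_
    rw [List.length_cons, Nat.cast_succ l.length, mul_add_one]
    linarith

/-- If the local rotation numbers at `x` and `y` differ, the variation between `x` and `y` is
unbounded on the powers of `g`. -/
theorem exists_lt_abs_pullbackVariation_zpow {X : Type u} [TopologicalSpace X]
    [PathConnectedSpace X] {a : SingularH1 X ℤ} {g : homeoFixing a} {α : singularZ1 X ℤ}
    (hα : singularClass α = a) {x y : X} (hx : IsBoundedOnPowers α x g)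
    (hy : IsBoundedOnPowers α y g)
    (hxy : localRotationNumber hα hx ≠ localRotationNumber hα hy) (B : ℤ) :
    ∃ n : ℤ, B < |pullbackVariation α x y ((g ^ n : homeoFixing a) : X ≃ₜ X)| := by
  by_contra! hB
  -- A bounded `V` would be a bounded cochain with `δV = -𝔊_y + 𝔊_x`, making the two classes equal.
  refine hxy.symm (QuotientAddGroup.eq.mpr
    ⟨fun u => pullbackVariation α x y (u : homeoFixing a), ⟨B, ?_⟩, ?_⟩)
  · rintro ⟨_, n, rfl⟩
    exact hB n
  · funext u v
    have h := gCocycle_sub_gCocycle hα x y (u : homeoFixing a) v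
    change _ - _ + _ = -gCocycle α y (u : homeoFixing a) (v : homeoFixing a) +
      gCocycle α x (u : homeoFixing a) (v : homeoFixing a)
    rw [neg_add_eq_sub, h]
    rfl

theorem mainTheorem4 {X : Type u} [TopologicalSpace X] [CompactSpace X] [PathConnectedSpace X]
    [LocallyPathConnectedSpace X] (a : SingularH1 X ℤ) (g : homeoFixing a)
    (α : singularZ1 X ℤ) (hα : singularClass α = a) (hloc : IsLocallyBoundedCocycle α)
    (x y : X) (hx : IsBoundedOnPowers α x g) (hy : IsBoundedOnPowers α y g)
    (hxy : localRotationNumber hα hx ≠ localRotationNumber hα hy) :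
    IsUndistorted g := by
  intro Γ hg _ S hSfin hS
  obtain ⟨τ, hτ⟩ := exists_isTranslationLength hS (⟨g, hg⟩ : Γ)
  refine ⟨τ, ?_, hτ⟩
  obtain ⟨M, hM, hMS⟩ := exists_abs_pullbackVariation_le_wordNorm hα hloc hSfin hS
  have hunb := exists_lt_abs_pullbackVariation_zpow hα hx hy hxy
  obtain ⟨Cx, hCx⟩ := hx
  obtain ⟨Cy, hCy⟩ := hy
  -- The defect of `V` on `⟨g⟩` is the difference of the two cocycles, hence at most `Cx + Cy`.
  obtain ⟨m, hm, hgrowth⟩ := exists_linear_growth_of_unbounded (g := g) (C := Cx + Cy)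
    (f := fun h : homeoFixing a => pullbackVariation α x y h) (fun m n => by
      rw [zpow_add, ← gCocycle_sub_gCocycle hα x y (g ^ m) (g ^ n)]
      exact (abs_sub _ _).trans (add_le_add (hCx ⟨g ^ m, m, rfl⟩ ⟨g ^ n, n, rfl⟩)
        (hCy ⟨g ^ m, m, rfl⟩ ⟨g ^ n, n, rfl⟩))) hunb
  refine hτ.pos_of_linear_growth hm hM fun k => ?_
  have h1 := hMS ((⟨g, hg⟩ : Γ) ^ (m * k)) x y
  rw [Subgroup.coe_pow] at h1
  exact_mod_cast (hgrowth k).trans h1
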